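/- Theorem 1.4. For a positive integer $r$, an integer $0\le k\le r-1$ and a real polynomial $f(x)=\sum_j a_jx^j$, let $f^{\langle r,k\rangle}(x)=\sum_{i\ge 0}a_{ri+k}x^i$, so that $f(x)=\sum_{k=0}^{r-1}x^k f^{\langle r,k\rangle}(x^r)$, and for a positive integer $n$ put $U^n_{r,k}f=\big((1+x+\cdots+x^{r-1})^n f\big)^{\langle r,k\rangle}$. A real polynomial is called real-rooted if it is constant (possibly zero) or all its complex zeros are real. For nonzero real-rooted polynomials $f,g$ with positive leading coefficients, $g$ interlaces $f$ if $\deg f=\deg g$ or $\deg f=\deg g+1$, and the zeros $u_1\ge u_2\ge\cdots$ of $f$ and $v_1\ge v_2\ge\cdots$ of $g$, listed with multiplicity, satisfy $\cdots\le v_2\le u_2\le v_1\le u_1$. By convention, the zero polynomial interlaces, and is interlaced by, every real-rooted polynomial (including itself). A sequence $(f_1,\dots,f_m)$ of real polynomials, each of which is zero or has positive leading coefficient, is interlacing if $f_i$ interlaces $f_j$ for all $1\le i<j\le m$. Let $n,r$ be positive integers and let $h$ be a real polynomial with nonnegative coefficients. If the sequence $(h^{\langle r,r-1\rangle},\dots,h^{\langle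 r,1\rangle},h^{\langle r,0\rangle})$ is interlacing, then the sequence $(U^n_{r,r-1}h,\dots,U^n_{r,1}h,U^n_{r,0}h)$ is also interlacing. -/

import Mathlib

open Polynomial

/-- The `r`-section `f^{⟨r,k⟩}` of a real polynomial `f = ∑ aⱼ xʲ`: the polynomial
`∑ᵢ a_{ri+k} xⁱ`. For `0 < r` no nonzero coefficient is cut off by the bound on `i`. -/
noncomputable def rSection (r k : ℕ) (f : ℝ[X]) : ℝ[X] :=
  ∑ i ∈ Finset.range (f.natDegree + 1), monomial i (f.coeff (r * i + k))

theorem coeff_rSection {r : ℕ} (hr : 0 < r) (k : ℕ) (f : ℝ[X]) (i : ℕ) :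
    (rSection r k f).coeff i = f.coeff (r * i + k) := by
  simp only [rSection, finsetSum_coeff, coeff_monomial, Finset.sum_ite_eq', Finset.mem_range]
  split_ifs with h
  · rfl
  · refine (coeff_eq_zero_of_natDegree_lt ?_).symm
    nlinarith

/-- The sections are exactly the polynomials `g₀, …, g_{r-1}` with
`f(x) = g₀(x^r) + x g₁(x^r) + ⋯ + x^{r-1} g_{r-1}(x^r)`. -/
theorem eq_sum_iff_rSection {r : ℕ} (hr : 0 < r) (f : ℝ[X]) (g : Fin r → ℝ[X]) :
    f = ∑ k : Fin r, X ^ (k : ℕ) * (g k).comp (X ^ r) ↔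
      ∀ k : Fin r, g k = rSection r k f := by
  have key : ∀ (g : Fin r → ℝ[X]) (i : ℕ) (k : Fin r),
      (∑ j : Fin r, X ^ (j : ℕ) * (g j).comp (X ^ r)).coeff (r * i + k) = (g k).coeff i := by
    intro g i k
    rw [finsetSum_coeff, Finset.sum_eq_single k]
    · rw [coeff_X_pow_mul, ← expand_eq_comp_X_pow, coeff_expand_mul' hr]
    · intro j _ hj
      rw [coeff_X_pow_mul', ← expand_eq_comp_X_pow]
      split_ifs with hle
      · rw [coeff_expand hr, if_neg]
        rintro ⟨c, hc⟩
        apply hj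
        have h1 : r * i + (k : ℕ) = r * c + (j : ℕ) := by omega
        have h2 := congrArg (· % r) h1
        simp only [Nat.mul_add_mod, Nat.mod_eq_of_lt k.isLt, Nat.mod_eq_of_lt j.isLt] at h2
        exact Fin.ext h2.symm
      · rfl
    · simp
  constructor
  · intro h k
    ext i
    rw [coeff_rSection hr, h, key]
  · intro h
    ext m
    have hm : m = r * (m / r) + ((⟨m % r, Nat.mod_lt _ hr⟩ : Fin r) : ℕ) :=
      (Nat.div_add_mod m r).symm
    rw [hm, key, h, coeff_rSection hr]

/-- `U^n_{r,k} h = ((1 + x + ⋯ + x^{r-1})^n h)^{⟨r,k⟩}`. -/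
noncomputable def veroneseU (n r k : ℕ) (h : ℝ[X]) : ℝ[X] :=
  rSection r k ((∑ i ∈ Finset.range r, X ^ i) ^ n * h)

/-- The real zeros of `f`, with multiplicity, in weakly decreasing order. -/
noncomputable def zerosDesc (f : ℝ[X]) : List ℝ :=
  f.roots.sort (· ≥ ·)

/-- `g` interlaces `f`. Either one of the two is zero and the other real-rooted (or zero), or both
are real-rooted with positive leading coefficients, `deg f ∈ {deg g, deg g + 1}`, and the zeros
`u₁ ≥ u₂ ≥ ⋯` of `f` and `v₁ ≥ v₂ ≥ ⋯` of `g` satisfy `⋯ ≤ v₂ ≤ u₂ ≤ v₁ ≤ u₁`.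
(Real-rooted means that `f` splits over `ℝ`, which includes all constants. The relation between a
constant `a ≥ 0` and `b x + c`, `b, c ≥ 0`, holds without a separate convention.) -/
def Interlaces (g f : ℝ[X]) : Prop :=
  (g = 0 ∧ f.Splits) ∨ (f = 0 ∧ g.Splits) ∨
    (g.Splits ∧ f.Splits ∧ 0 < g.leadingCoeff ∧ 0 < f.leadingCoeff ∧
      (f.natDegree = g.natDegree ∨ f.natDegree = g.natDegree + 1) ∧
      (∀ (i : ℕ) (hv : i < (zerosDesc g).length) (hu : i < (zerosDesc f).length),
        (zerosDesc g)[i] ≤ (zerosDesc f)[i]) ∧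
      (∀ (i : ℕ) (hu : i + 1 < (zerosDesc f).length) (hv : i < (zerosDesc g).length),
        (zerosDesc f)[i + 1] ≤ (zerosDesc g)[i]))

/-- A finite sequence of real polynomials, each zero or with positive leading coefficient, is
interlacing if every earlier member interlaces every later one. -/
def IsInterlacingSeq {m : ℕ} (f : Fin m → ℝ[X]) : Prop :=
  (∀ i, f i = 0 ∨ 0 < (f i).leadingCoeff) ∧ ∀ i j, i < j → Interlaces (f i) (f j)

/-!
The factor `S = 1 + x + ⋯ + x^{r-1}` is multiplied in `n` times, so it is enough to show that
multiplication by `S` preserves interlacing of the sections. Collecting the residues modulo `r`, the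
section of index `k` of `S h` is `∑_{m ≤ k} h_m + x ∑_{m > k} h_m`, where `h_m` are the sections of
`h` (`rSection_geomSum_mul`).

Interlacing is translated into a condition on values in the upper half-plane. If `g` interlaces `f`
and the zeros of both are nonpositive, then `f(z) / g(z)` lies in the sector `0 ≤ arg ≤ arg z`
(`Interlaces.argOrdered`). This condition, `ArgOrdered`, is biadditive, so it passes to sums of
consecutive members of the sequence. With `a, b, c` the sums of `h_m(z)` over the residues `m > k`,
`k' < m ≤ k` and `m ≤ k'`, the new sections of index `k` and `k'` take the values `c + b + z a` and
`c + z (a + b)`, and the second has argument at least that of the first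
(`ArgOrdered.im_shift_nonneg`). The same condition shows that such a sum vanishes only if all its
terms do, so the new sections have no zeros off the real axis.

Conversely, let `f` and `g` be real-rooted with positive leading coefficients and suppose that
`im (f * conj g) ≥ 0` on the upper half-plane. The continuous argument of `f / g` avoids the
intervals where `sin` is negative, and it is near `0` close to a real point to the right of all
zeros; hence it stays in `[0, π]` (`argSum_sub_mem_Icc`). Near a real point `t` it tends to `π` times
the difference of the numbers of zeros of `f` and of `g` to the right of `t`. This difference is
therefore `0` or `1` for every `t` that is not a zero, which is interlacing
(`interlaces_of_im_nonneg`).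
-/

open ComplexConjugate Filter Topology

/-! ### The sector condition -/

/-- `q / p` lies in the closed sector `0 ≤ arg ≤ arg z`, where `0 < im z`; the two inequalities make
the condition biadditive in `(p, q)` and leave it true when `p` or `q` vanishes. -/
def ArgOrdered (z p q : ℂ) : Prop :=
  0 ≤ (q * conj p).im ∧ 0 ≤ (z * p * conj q).im

namespace ArgOrdered

variable {z p q : ℂ}

theorem refl (hz : 0 < z.im) (p : ℂ) : ArgOrdered z p p := by
  constructor
  · rw [Complex.mul_conj]; simp
  · rw [mul_assoc, Complex.mul_conj, Complex.im_mul_ofReal]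
    exact mul_nonneg hz.le (Complex.normSq_nonneg p)

theorem sum_left {ι : Type*} {s : Finset ι} {p : ι → ℂ} (h : ∀ i ∈ s, ArgOrdered z (p i) q) :
    ArgOrdered z (∑ i ∈ s, p i) q := by
  constructor
  · rw [map_sum, Finset.mul_sum, Complex.im_sum]
    exact Finset.sum_nonneg fun i hi => (h i hi).1
  · rw [Finset.mul_sum, Finset.sum_mul, Complex.im_sum]
    exact Finset.sum_nonneg fun i hi => (h i hi).2

theorem sum_right {ι : Type*} {s : Finset ι} {q : ι → ℂ} (h : ∀ i ∈ s, ArgOrdered z p (q i)) :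
    ArgOrdered z p (∑ i ∈ s, q i) := by
  constructor
  · rw [Finset.sum_mul, Complex.im_sum]
    exact Finset.sum_nonneg fun i hi => (h i hi).1
  · rw [map_sum, Finset.mul_sum, Complex.im_sum]
    exact Finset.sum_nonneg fun i hi => (h i hi).2

/-- Here `q / p = -1`, which lies outside the sector. -/
theorem eq_zero_of_add_eq_zero (hz : 0 < z.im) (h : ArgOrdered z p q) (h0 : p + q = 0) :
    p = 0 ∧ q = 0 := by
  have hq : q = -p := by linear_combination h0
  have h2 := h.2
  rw [hq, map_neg, mul_neg, mul_assoc, Complex.mul_conj, Complex.neg_im,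
    Complex.im_mul_ofReal] at h2
  have hp : p = 0 := by
    by_contra hp
    have := mul_pos hz (Complex.normSq_pos.mpr hp)
    linarith
  exact ⟨hp, by simp [hq, hp]⟩

/-- Here `q / p = -z`, which lies in the lower half-plane. -/
theorem eq_zero_of_add_mul_eq_zero (hz : 0 < z.im) (h : ArgOrdered z p q) (h0 : q + z * p = 0) :
    p = 0 ∧ q = 0 := by
  have hq : q = -(z * p) := by linear_combination h0
  have h1 := h.1
  rw [hq, neg_mul, mul_assoc, Complex.mul_conj, Complex.neg_im,
    Complex.im_mul_ofReal] at h1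
  have hp : p = 0 := by
    by_contra hp
    have := mul_pos hz (Complex.normSq_pos.mpr hp)
    linarith
  exact ⟨hp, by simp [hq, hp]⟩

/-- Moving the middle block `b` of three consecutive blocks across the factor `z` can only increase
the argument. -/
theorem im_shift_nonneg (hz : 0 < z.im) {a b c : ℂ} (hab : ArgOrdered z a b)
    (hbc : ArgOrdered z b c) :
    0 ≤ ((c + z * (a + b)) * conj (c + b + z * a)).im := by
  have e : ((c + z * (a + b)) * conj (c + b + z * a)).im =
      (c * conj b).im + (z * b * conj c).im + (z * a * conj b).im +
      Complex.normSq b * z.im + Complex.normSq z * (b * conj a).im := by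
    simp only [map_add, map_mul, Complex.add_im, Complex.mul_im, Complex.mul_re, Complex.add_re,
      Complex.conj_re, Complex.conj_im, Complex.normSq_apply]
    ring
  rw [e]
  have := mul_nonneg (Complex.normSq_nonneg b) hz.le
  have := mul_nonneg (Complex.normSq_nonneg z) hab.1
  linarith [hab.2, hbc.1, hbc.2]

/-- A vanishing sum of vectors, pairwise ordered by argument within a sector of opening less than
`π`, has vanishing terms. -/
theorem eq_zero_of_sum_eq_zero (hz : 0 < z.im) {w : ℕ → ℂ} (s : Finset ℕ)
    (hw : ∀ i ∈ s, ∀ j ∈ s, j < i → ArgOrdered z (w i) (w j)) (h0 : ∑ i ∈ s, w i = 0) :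
    ∀ i ∈ s, w i = 0 := by
  induction s using Finset.induction_on_max with
  | empty => simp
  | insert a s ha ih =>
    have has : a ∉ s := fun h => lt_irrefl _ (ha a h)
    rw [Finset.sum_insert has] at h0
    have h1 : ArgOrdered z (w a) (∑ i ∈ s, w i) :=
      sum_right fun i hi => hw a (by simp) i (by simp [hi]) (ha i hi)
    obtain ⟨h2, h3⟩ := h1.eq_zero_of_add_eq_zero hz h0
    intro i hi
    rcases Finset.mem_insert.mp hi with rfl | hi
    · exact h2
    · exact ih (fun i hi j hj => hw i (by simp [hi]) j (by simp [hj])) h3 i hi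

theorem ofReal_mul (h : ArgOrdered z p q) {a b : ℝ} (ha : 0 ≤ a) (hb : 0 ≤ b) :
    ArgOrdered z (a * p) (b * q) := by
  have e1 : ((b * q) * conj (a * p)).im = a * b * (q * conj p).im := by
    rw [map_mul, Complex.conj_ofReal, ← Complex.im_ofReal_mul]; push_cast; ring_nf
  have e2 : (z * (a * p) * conj (b * q)).im = a * b * (z * p * conj q).im := by
    rw [map_mul, Complex.conj_ofReal, ← Complex.im_ofReal_mul]; push_cast; ring_nf
  exact ⟨e1 ▸ mul_nonneg (mul_nonneg ha hb) h.1, e2 ▸ mul_nonneg (mul_nonneg ha hb) h.2⟩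

end ArgOrdered

/-! ### From interlacing zeros to the sector condition -/

/-- Induction on the number of zeros, splitting off the largest one and exchanging the roles of the
two lists. The second inequality, with a free bound `a` for the zeros, is what the induction needs;
`a = 0` gives the second half of `ArgOrdered`. -/
theorem im_prod_nonneg_of_interlacing {z : ℂ} (hz : 0 < z.im) (u v : List ℝ)
    (hlen : u.length = v.length ∨ u.length = v.length + 1)
    (h1 : ∀ (i : ℕ) (hv : i < v.length) (hu : i < u.length), v[i] ≤ u[i])
    (h2 : ∀ (i : ℕ) (hu : i + 1 < u.length) (hv : i < v.length), u[i + 1] ≤ v[i]) :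
    0 ≤ ((u.map fun x : ℝ => z - x).prod * conj (v.map fun x : ℝ => z - x).prod).im ∧
    ∀ a : ℝ, (∀ hu : 0 < u.length, u[0] ≤ a) →
      0 ≤ ((z - a) * (v.map fun x : ℝ => z - x).prod *
        conj (u.map fun x : ℝ => z - x).prod).im := by
  obtain ⟨N, hN⟩ : ∃ N, u.length + v.length = N := ⟨_, rfl⟩
  induction N using Nat.strong_induction_on generalizing u v with
  | _ N ih =>
  cases u with
  | nil =>
    have hv : v = [] := by
      apply List.eq_nil_of_length_eq_zero
      simp at hlen
      omega
    subst hv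
    simpa using hz.le
  | cons b u =>
    have := ih (u.length + v.length) (by simp at hN; omega) v u
      (by simp at hlen; omega)
      (fun i hu hv => h2 i (by simpa using hu) hv)
      (fun i hv hu => h1 (i + 1) hv (by simpa using hu)) (by omega)
    obtain ⟨i1, i2⟩ := this
    have i3 := i2 b fun hv => h1 0 hv (by simp)
    simp only [List.map_cons, List.prod_cons]
    set F := (u.map fun x : ℝ => z - x).prod
    set G := (v.map fun x : ℝ => z - x).prod
    refine ⟨i3, fun a ha => ?_⟩
    have hab : b ≤ a := ha (by simp)
    have e : ((z - a) * G * conj ((z - b) * F)).im =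
        Complex.normSq (z - b) * (G * conj F).im +
          (a - b) * ((z - b) * F * conj G).im := by
      simp only [map_mul, map_sub, Complex.conj_ofReal, Complex.mul_im, Complex.mul_re,
        Complex.sub_re, Complex.sub_im, Complex.ofReal_re, Complex.ofReal_im,
        Complex.conj_re, Complex.conj_im, Complex.normSq_apply]
      ring
    rw [e]
    exact add_nonneg (mul_nonneg (Complex.normSq_nonneg _) i1)
      (mul_nonneg (sub_nonneg.mpr hab) i3)

theorem Polynomial.Splits.aeval_eq_prod_roots_complex {f : ℝ[X]} (hf : f.Splits) (z : ℂ) :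
    aeval z f = f.leadingCoeff * (f.roots.map fun x : ℝ => z - x).prod := by
  conv_lhs => rw [hf.eq_prod_roots]
  rw [map_mul, aeval_C, map_multiset_prod, Multiset.map_map]
  simp

theorem aeval_eq_prod_zerosDesc {f : ℝ[X]} (hf : f.Splits) (z : ℂ) :
    aeval z f = f.leadingCoeff * ((zerosDesc f).map fun x : ℝ => z - x).prod := by
  rw [hf.aeval_eq_prod_roots_complex, ← Multiset.prod_coe, ← Multiset.map_coe, zerosDesc,
    Multiset.sort_eq]

theorem length_zerosDesc {f : ℝ[X]} (hf : f.Splits) : (zerosDesc f).length = f.natDegree := by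
  rw [zerosDesc, Multiset.length_sort, hf.natDegree_eq_card_roots]

theorem Polynomial.Splits.aeval_ne_zero_of_im_pos {f : ℝ[X]} (hf : f.Splits) (h0 : f ≠ 0) {z : ℂ}
    (hz : 0 < z.im) : aeval z f ≠ 0 := by
  rw [hf.aeval_eq_prod_roots_complex]
  refine mul_ne_zero (by simpa using h0) (Multiset.prod_ne_zero ?_)
  rw [Multiset.mem_map]
  rintro ⟨x, -, hx⟩
  have := congrArg Complex.im hx
  simp at this
  exact hz.ne' this

/-- A real polynomial without zeros in the upper half-plane is real-rooted. -/
theorem splits_of_aeval_ne_zero {f : ℝ[X]} (h : ∀ z : ℂ, 0 < z.im → aeval z f ≠ 0) :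
    f.Splits := by
  refine Splits.of_splits_map (algebraMap ℝ ℂ) (IsAlgClosed.splits _) fun z hz => ?_
  have h0 : aeval z f = 0 := by
    simpa [aeval_def, eval_map] using (isRoot_of_mem_roots hz)
  have h0' : aeval (conj z) f = 0 := by rw [aeval_conj, h0, map_zero]
  have hz : z.im = 0 := by
    rcases lt_trichotomy z.im 0 with hlt | heq | hgt
    · exact absurd h0' (h _ (by simpa using hlt))
    · exact heq
    · exact absurd h0 (h _ hgt)
  exact ⟨z.re, Complex.ext (by simp) (by simp [hz])⟩

theorem eval_pos_of_coeff_nonneg {f : ℝ[X]} (hf : ∀ i, 0 ≤ f.coeff i) (h0 : f ≠ 0) {x : ℝ}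
    (hx : 0 < x) : 0 < f.eval x := by
  rw [eval_eq_sum_range]
  refine Finset.sum_pos' (fun i _ => mul_nonneg (hf i) (by positivity))
    ⟨f.natDegree, by simp, mul_pos ?_ (by positivity)⟩
  exact lt_of_le_of_ne (hf _) (Ne.symm (by simpa using h0))

/-- Nonnegative coefficients put the zeros in `(-∞, 0]`; this is what makes the sector end at
`arg z`. -/
theorem Interlaces.argOrdered {f g : ℝ[X]} (hfg : Interlaces g f) (hf : ∀ i, 0 ≤ f.coeff i)
    {z : ℂ} (hz : 0 < z.im) : ArgOrdered z (aeval z g) (aeval z f) := by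
  rcases hfg with ⟨rfl, -⟩ | ⟨rfl, -⟩ | ⟨hgs, hfs, hg0, hf0, hdeg, h1, h2⟩
  · simp [ArgOrdered]
  · simp [ArgOrdered]
  · rw [aeval_eq_prod_zerosDesc hfs, aeval_eq_prod_zerosDesc hgs]
    refine ArgOrdered.ofReal_mul ?_ hg0.le hf0.le
    obtain ⟨h3, h4⟩ := im_prod_nonneg_of_interlacing hz (zerosDesc f) (zerosDesc g)
      (by rwa [length_zerosDesc hfs, length_zerosDesc hgs]) h1 h2
    refine ⟨h3, ?_⟩
    have h5 := h4 0 fun hu => by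
      by_contra! hpos
      have hmem : (zerosDesc f)[0] ∈ f.roots :=
        (Multiset.mem_sort (· ≥ ·)).mp (List.getElem_mem hu)
      exact (eval_pos_of_coeff_nonneg hf (leadingCoeff_ne_zero.mp hf0.ne') hpos).ne'
        (isRoot_of_mem_roots hmem)
    simpa using h5

/-! ### Counting entries of sorted lists -/

theorem List.Pairwise.lt_countP_of_lt_getElem {l : List ℝ} (hl : l.Pairwise (· ≥ ·)) {t : ℝ} {i : ℕ}
    (hi : i < l.length) (h : t < l[i]) : i < l.countP (t < ·) := by
  induction l generalizing i with
  | nil => simp at hi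
  | cons a l ih =>
    rw [List.pairwise_cons] at hl
    cases i with
    | zero =>
      have : t < a := by simpa using h
      simp [this]
    | succ i =>
      have hi' : i < l.length := by simpa using hi
      have h' : t < l[i] := by simpa using h
      have : t < a := h'.trans_le (hl.1 _ (List.getElem_mem hi'))
      have := ih hl.2 hi' h'
      simp [*]

theorem List.Pairwise.countP_le_of_getElem_le {l : List ℝ} (hl : l.Pairwise (· ≥ ·)) {t : ℝ} {i : ℕ}
    (hi : i < l.length) (h : l[i] ≤ t) : l.countP (t < ·) ≤ i := by
  induction l generalizing i with
  | nil => simp at hi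
  | cons a l ih =>
    rw [List.pairwise_cons] at hl
    cases i with
    | zero =>
      have ha : a ≤ t := by simpa using h
      rw [Nat.le_zero, List.countP_eq_zero]
      intro x hx
      rcases List.mem_cons.mp hx with rfl | hx
      · simpa using ha
      · simpa using (hl.1 x hx).trans ha
    | succ i =>
      have hi' : i < l.length := by simpa using hi
      have := ih hl.2 hi' (by simpa using h)
      rw [List.countP_cons]
      split_ifs <;> omega

/-! ### The continuous argument on the upper half-plane -/

/-- A continuous choice, on the upper half-plane, of the argument of `∏ (z - u)`. -/
noncomputable def argSum (U : Multiset ℝ) (z : ℂ) : ℝ :=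
  (U.map fun u : ℝ => (z - u).arg).sum

theorem continuousOn_argSum (U : Multiset ℝ) : ContinuousOn (argSum U) {z : ℂ | 0 < z.im} := by
  unfold argSum
  refine continuousOn_multiset_sum U fun u _ => ?_
  refine Complex.continuousOn_arg.comp (by fun_prop) fun z hz => ?_
  exact Or.inr (by simpa using (ne_of_gt hz))

theorem exists_prod_eq_exp_argSum (U : Multiset ℝ) {z : ℂ} (hz : 0 < z.im) :
    ∃ ρ : ℝ, 0 < ρ ∧ (U.map fun u : ℝ => z - u).prod = ρ * Complex.exp (argSum U z * Complex.I) := by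
  induction U using Multiset.induction_on with
  | empty => exact ⟨1, one_pos, by simp [argSum]⟩
  | cons u U ih =>
    obtain ⟨ρ, hρ, h⟩ := ih
    have hne : z - u ≠ 0 := fun h0 => by
      have := congrArg Complex.im h0
      simp at this
      exact hz.ne' this
    refine ⟨‖z - u‖ * ρ, mul_pos (norm_pos_iff.mpr hne) hρ, ?_⟩
    rw [Multiset.map_cons, Multiset.prod_cons, h]
    conv_lhs => rw [← Complex.norm_mul_exp_arg_mul_I (z - u)]
    simp only [argSum, Multiset.map_cons, Multiset.sum_cons, Complex.ofReal_add, add_mul,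
      Complex.exp_add, Complex.ofReal_mul]
    ring

/-- Close to `t`, the argument of `z - u` is near `π` if `t < u` and near `0` if `u < t`. -/
theorem tendsto_argSum_nhdsWithin (U : Multiset ℝ) {t : ℝ} (ht : t ∉ U) :
    Tendsto (argSum U) (𝓝[{z : ℂ | 0 < z.im}] (t : ℂ)) (𝓝 (Real.pi * U.countP (t < ·))) := by
  induction U using Multiset.induction_on with
  | empty =>
    have e : argSum 0 = fun _ => 0 := by funext z; simp [argSum]
    rw [e, Multiset.countP_zero, Nat.cast_zero, mul_zero]
    exact tendsto_const_nhds
  | cons u U ih =>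
    rw [Multiset.mem_cons, not_or] at ht
    have e : argSum (u ::ₘ U) = fun z : ℂ => (z - u).arg + argSum U z := by
      funext z; simp [argSum]
    have hsub : Tendsto (fun z : ℂ => z - u) (𝓝[{z : ℂ | 0 < z.im}] (t : ℂ))
        (𝓝[{z : ℂ | 0 ≤ z.im}] ((t - u : ℝ) : ℂ)) := by
      refine tendsto_nhdsWithin_iff.mpr ⟨?_, ?_⟩
      · have : Continuous fun z : ℂ => z - u := by fun_prop
        have := this.tendsto (t : ℂ)
        rw [Complex.ofReal_sub]
        exact this.mono_left nhdsWithin_le_nhds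
      · filter_upwards [self_mem_nhdsWithin] with z hz
        simpa using (le_of_lt hz)
    have key : Tendsto (fun z : ℂ => (z - u).arg) (𝓝[{z : ℂ | 0 < z.im}] (t : ℂ))
        (𝓝 (if t < u then Real.pi else 0)) := by
      split_ifs with h
      · exact (Complex.tendsto_arg_nhdsWithin_im_nonneg_of_re_neg_of_im_zero
          (by simpa using h) (by simp)).comp hsub
      · have hpos : 0 < t - u := sub_pos.mpr (lt_of_le_of_ne (not_lt.mp h) (Ne.symm ht.1))
        have hc := (Complex.continuousAt_arg (x := ((t - u : ℝ) : ℂ))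
          (Or.inl (by simpa using hpos))).tendsto
        rw [Complex.arg_ofReal_of_nonneg hpos.le] at hc
        exact hc.comp (hsub.mono_right nhdsWithin_le_nhds)
    rw [e]
    convert key.add (ih ht.2) using 2
    rw [Multiset.countP_cons]
    split_ifs <;> push_cast <;> ring

instance neBot_nhdsWithin_upperHalfPlane (t : ℝ) : (𝓝[{z : ℂ | 0 < z.im}] (t : ℂ)).NeBot := by
  rw [← mem_closure_iff_nhdsWithin_neBot, Complex.closure_setOfPred_lt_im]
  simp

/-- If `im (f * conj g) ≥ 0` on the upper half-plane, where `f = ∏ (z - u)` and `g = ∏ (z - v)`, then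
the continuous argument of `f / g` lies in `[0, π]`: it avoids the intervals where `sin` is negative
and it is close to `0` near a real point to the right of all zeros. -/
theorem argSum_sub_mem_Icc {U V : Multiset ℝ}
    (h : ∀ z : ℂ, 0 < z.im → 0 ≤ ((U.map fun u : ℝ => z - u).prod *
      conj (V.map fun v : ℝ => z - v).prod).im) {z : ℂ} (hz : 0 < z.im) :
    argSum U z - argSum V z ∈ Set.Icc 0 Real.pi := by
  have hpi := Real.pi_pos
  have hsin : ∀ z : ℂ, 0 < z.im → 0 ≤ Real.sin (argSum U z - argSum V z) := by
    intro z hz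
    obtain ⟨ρ, hρ, hU⟩ := exists_prod_eq_exp_argSum U hz
    obtain ⟨σ, hσ, hV⟩ := exists_prod_eq_exp_argSum V hz
    have h1 := h z hz
    have e : (ρ * Complex.exp (argSum U z * Complex.I)) *
        conj (σ * Complex.exp (argSum V z * Complex.I)) =
        ((ρ * σ : ℝ) : ℂ) * Complex.exp ((argSum U z - argSum V z : ℝ) * Complex.I) := by
      rw [map_mul, Complex.conj_ofReal, ← Complex.exp_conj, map_mul, Complex.conj_ofReal,
        Complex.conj_I, Complex.ofReal_sub, sub_mul, sub_eq_add_neg, Complex.exp_add]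
      push_cast
      ring_nf
    rw [hU, hV, e, Complex.im_ofReal_mul, Complex.exp_ofReal_mul_I_im] at h1
    exact nonneg_of_mul_nonneg_right h1 (mul_pos hρ hσ)
  have hcont : ContinuousOn (fun z => argSum U z - argSum V z) {z : ℂ | 0 < z.im} :=
    (continuousOn_argSum U).sub (continuousOn_argSum V)
  have himg := ((convex_halfSpace_im_gt 0).isPreconnected.image _ hcont).ordConnected
  -- a base point with argument close to `0`
  obtain ⟨t, ht⟩ : ∃ t : ℝ, ∀ x ∈ U + V, x < t := by
    obtain ⟨M, hM⟩ := (U + V).toFinset.bddAbove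
    exact ⟨M + 1, fun x hx => (hM (by simpa using hx)).trans_lt (lt_add_one M)⟩
  have hlim := (tendsto_argSum_nhdsWithin U (t := t)
      fun hx => lt_irrefl _ (ht t (by simp [hx]))).sub
    (tendsto_argSum_nhdsWithin V (t := t) fun hx => lt_irrefl _ (ht t (by simp [hx])))
  have hU0 : U.countP (t < ·) = 0 :=
    Multiset.countP_eq_zero.mpr fun x hx => not_lt.mpr (ht x (by simp [hx])).le
  have hV0 : V.countP (t < ·) = 0 :=
    Multiset.countP_eq_zero.mpr fun x hx => not_lt.mpr (ht x (by simp [hx])).le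
  rw [hU0, hV0] at hlim
  simp only [Nat.cast_zero, mul_zero, sub_zero] at hlim
  obtain ⟨w, hw1, hw2⟩ := ((hlim.eventually (Ioo_mem_nhds (neg_lt_zero.mpr hpi) hpi)).and
    self_mem_nhdsWithin).exists
  have hw2 : 0 < w.im := hw2
  have hw0 : 0 ≤ argSum U w - argSum V w := by
    by_contra! hneg
    exact absurd (hsin w hw2) (not_le.mpr (Real.sin_neg_of_neg_of_neg_pi_lt hneg hw1.1))
  have hwm : argSum U w - argSum V w ∈ (fun z => argSum U z - argSum V z) '' {z : ℂ | 0 < z.im} :=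
    ⟨w, hw2, rfl⟩
  have hzm : argSum U z - argSum V z ∈ (fun z => argSum U z - argSum V z) '' {z : ℂ | 0 < z.im} :=
    ⟨z, hz, rfl⟩
  constructor
  · by_contra! hneg
    obtain ⟨y, hy, hye⟩ := himg.out hzm hwm
      (show max (argSum U z - argSum V z) (-(Real.pi / 2)) ∈ _ from
        ⟨le_max_left _ _, max_le (hneg.le.trans hw0) (by linarith)⟩)
    have := hsin y hy
    simp only at hye
    rw [hye] at this
    exact absurd this (not_le.mpr (Real.sin_neg_of_neg_of_neg_pi_lt
      (max_lt hneg (by linarith)) (lt_of_lt_of_le (by linarith) (le_max_right _ _))))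
  · by_contra! hgt
    obtain ⟨y, hy, hye⟩ := himg.out hwm hzm
      (show min (argSum U z - argSum V z) (3 * Real.pi / 2) ∈ _ from
        ⟨le_min (hw1.2.le.trans hgt.le) (by linarith [hw1.2]), min_le_left _ _⟩)
    have := hsin y hy
    simp only at hye
    rw [hye, ← Real.sin_sub_two_pi] at this
    refine absurd this (not_le.mpr (Real.sin_neg_of_neg_of_neg_pi_lt ?_ ?_))
    · linarith [min_le_right (argSum U z - argSum V z) (3 * Real.pi / 2)]
    · have : Real.pi < min (argSum U z - argSum V z) (3 * Real.pi / 2) :=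
        lt_min hgt (by linarith)
      linarith

/-- Near `t`, the argument of `f / g` tends to `π` times the difference of the two counts. -/
theorem countP_le_countP_le_of_im_nonneg {U V : Multiset ℝ}
    (h : ∀ z : ℂ, 0 < z.im → 0 ≤ ((U.map fun u : ℝ => z - u).prod *
      conj (V.map fun v : ℝ => z - v).prod).im) {t : ℝ} (htU : t ∉ U) (htV : t ∉ V) :
    V.countP (t < ·) ≤ U.countP (t < ·) ∧ U.countP (t < ·) ≤ V.countP (t < ·) + 1 := by
  have hpi := Real.pi_pos
  have hlim := (tendsto_argSum_nhdsWithin U htU).sub (tendsto_argSum_nhdsWithin V htV)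
  have hm := isClosed_Icc.mem_of_tendsto hlim
    (by filter_upwards [self_mem_nhdsWithin] with z hz using argSum_sub_mem_Icc h hz)
  rw [← mul_sub] at hm
  have h1 := nonneg_of_mul_nonneg_right hm.1 hpi
  have h2 : (U.countP (t < ·) : ℝ) - V.countP (t < ·) ≤ 1 :=
    le_of_mul_le_mul_left (by simpa using hm.2) hpi
  constructor
  · exact_mod_cast sub_nonneg.mp h1
  · exact_mod_cast (by linarith : (U.countP (t < ·) : ℝ) ≤ V.countP (t < ·) + 1)

/-! ### From the upper half-plane back to interlacing -/

/-- At a real `t` that is no zero, the numbers of zeros of `f` and of `g` to the right of `t` differ by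
`0` or `1`; a violated inequality between sorted zeros would leave room for a `t` breaking this. -/
theorem interlaces_of_im_nonneg {f g : ℝ[X]} (hf : f.Splits) (hg : g.Splits)
    (hf0 : 0 < f.leadingCoeff) (hg0 : 0 < g.leadingCoeff)
    (h : ∀ z : ℂ, 0 < z.im → 0 ≤ (aeval z f * conj (aeval z g)).im) : Interlaces g f := by
  have hroots : ∀ z : ℂ, 0 < z.im → 0 ≤ ((f.roots.map fun u : ℝ => z - u).prod *
      conj (g.roots.map fun v : ℝ => z - v).prod).im := by
    intro z hz
    have h1 := h z hz
    rw [hf.aeval_eq_prod_roots_complex, hg.aeval_eq_prod_roots_complex, map_mul,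
      Complex.conj_ofReal, mul_mul_mul_comm, ← Complex.ofReal_mul, Complex.im_ofReal_mul] at h1
    exact nonneg_of_mul_nonneg_right h1 (mul_pos hf0 hg0)
  have hcount : ∀ t : ℝ, t ∉ f.roots → t ∉ g.roots →
      (zerosDesc g).countP (t < ·) ≤ (zerosDesc f).countP (t < ·) ∧
      (zerosDesc f).countP (t < ·) ≤ (zerosDesc g).countP (t < ·) + 1 := by
    intro t htf htg
    simp only [zerosDesc, ← Multiset.coe_countP, Multiset.sort_eq]
    exact countP_le_countP_le_of_im_nonneg hroots htf htg
  have havoid : ∀ a b : ℝ, a < b → ∃ t ∈ Set.Ioo a b, t ∉ f.roots ∧ t ∉ g.roots := by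
    intro a b hab
    obtain ⟨t, ht, htn⟩ := (Set.Ioo_infinite hab).exists_notMem_finset (f.roots + g.roots).toFinset
    exact ⟨t, ht, by simpa only [Multiset.mem_toFinset, Multiset.mem_add, not_or] using htn⟩
  have hsf : (zerosDesc f).Pairwise (· ≥ ·) := Multiset.pairwise_sort _ _
  have hsg : (zerosDesc g).Pairwise (· ≥ ·) := Multiset.pairwise_sort _ _
  refine Or.inr (Or.inr ⟨hg, hf, hg0, hf0, ?_, fun i hv hu => ?_, fun i hu hv => ?_⟩)
  · -- count the zeros to the right of a point below all of them
    obtain ⟨m, hm⟩ := (f.roots + g.roots).toFinset.bddBelow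
    have hlt : ∀ x ∈ f.roots + g.roots, m - 1 < x := fun x hx =>
      (sub_one_lt m).trans_le (hm (by simpa only [SetLike.mem_coe, Multiset.mem_toFinset] using hx))
    have h1 := countP_le_countP_le_of_im_nonneg hroots (t := m - 1)
      (fun hx => lt_irrefl _ (hlt _ (Multiset.mem_add.mpr (Or.inl hx))))
      (fun hx => lt_irrefl _ (hlt _ (Multiset.mem_add.mpr (Or.inr hx))))
    rw [Multiset.countP_eq_card.mpr fun x hx => hlt x (Multiset.mem_add.mpr (Or.inl hx)),
      Multiset.countP_eq_card.mpr fun x hx => hlt x (Multiset.mem_add.mpr (Or.inr hx)),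
      ← hf.natDegree_eq_card_roots, ← hg.natDegree_eq_card_roots] at h1
    omega
  · by_contra! hlt
    obtain ⟨t, ht, htf, htg⟩ := havoid _ _ hlt
    have h1 := hsg.lt_countP_of_lt_getElem hv ht.2
    have h2 := hsf.countP_le_of_getElem_le hu ht.1.le
    have := (hcount t htf htg).1
    omega
  · by_contra! hlt
    obtain ⟨t, ht, htf, htg⟩ := havoid _ _ hlt
    have h1 := hsf.lt_countP_of_lt_getElem hu ht.2
    have h2 := hsg.countP_le_of_getElem_le hv ht.1.le
    have := (hcount t htf htg).2
    omega

/-! ### Sections of `(1 + x + ⋯ + x^{r-1}) h` -/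

theorem coeff_geomSum_mul (r : ℕ) (h : ℝ[X]) (d : ℕ) :
    ((∑ i ∈ Finset.range r, X ^ i) * h).coeff d =
      ∑ j ∈ Finset.range r, if j ≤ d then h.coeff (d - j) else 0 := by
  simp [Finset.sum_mul, finsetSum_coeff, coeff_X_pow_mul']

/-- The sections of `(1 + x + ⋯ + x^{r-1}) h` in terms of those of `h`. -/
theorem rSection_geomSum_mul {r k : ℕ} (hr : 0 < r) (hk : k < r) (h : ℝ[X]) :
    rSection r k ((∑ i ∈ Finset.range r, X ^ i) * h) =
      ∑ m ∈ Finset.range (k + 1), rSection r m h +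
        X * ∑ m ∈ Finset.Ico (k + 1) r, rSection r m h := by
  have hsplit : ∑ m ∈ Finset.range (k + 1), rSection r m h +
        X * ∑ m ∈ Finset.Ico (k + 1) r, rSection r m h =
      ∑ m ∈ Finset.range r, (if m ≤ k then rSection r m h else X * rSection r m h) := by
    rw [← Finset.sum_range_add_sum_Ico _ (Nat.succ_le_of_lt hk), Finset.mul_sum]
    congr 1
    · exact Finset.sum_congr rfl fun m hm => by
        rw [if_pos (by simpa [Nat.lt_succ_iff] using hm)]
    · exact Finset.sum_congr rfl fun m hm => by
        rw [if_neg (by have := (Finset.mem_Ico.mp hm).1; omega)]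
  rw [hsplit]
  ext i
  rw [coeff_rSection hr, coeff_geomSum_mul, finsetSum_coeff]
  -- the factor `X ^ j` moves the section of index `m` with `m + j ≡ k` modulo `r` to index `k`
  have hinv : ∀ j, j < r → (if j ≤ k then k - j else r + k - j) < r := fun j hj => by
    split_ifs <;> omega
  refine Finset.sum_nbij' (fun j => if j ≤ k then k - j else r + k - j)
    (fun j => if j ≤ k then k - j else r + k - j) ?_ ?_ ?_ ?_ ?_
  · simpa using hinv
  · simpa using hinv
  · intro j hj
    have := Finset.mem_range.mp hj
    split_ifs <;> omega
  · intro j hj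
    have := Finset.mem_range.mp hj
    split_ifs <;> omega
  · intro j hj
    have := Finset.mem_range.mp hj
    by_cases hjk : j ≤ k
    · rw [if_pos hjk, if_pos (Nat.sub_le k j), coeff_rSection hr, if_pos (by omega)]
      congr 1; omega
    · rw [if_neg hjk, if_neg (show ¬ r + k - j ≤ k by omega)]
      cases i with
      | zero => simp [hjk]
      | succ i =>
        have hmul : r * (i + 1) = r * i + r := by ring
        rw [coeff_X_mul, coeff_rSection hr, if_pos (by omega)]
        congr 1
        omega

theorem coeff_geomSum_mul_nonneg (r : ℕ) {h : ℝ[X]} (hh : ∀ i, 0 ≤ h.coeff i) (d : ℕ) :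
    0 ≤ ((∑ i ∈ Finset.range r, X ^ i) * h).coeff d := by
  rw [coeff_geomSum_mul]
  exact Finset.sum_nonneg fun j _ => by split_ifs <;> simp [hh]

/-! ### Multiplication by `1 + x + ⋯ + x^{r-1}` -/

theorem leadingCoeff_pos_of_coeff_nonneg {f : ℝ[X]} (hf : ∀ i, 0 ≤ f.coeff i) (h0 : f ≠ 0) :
    0 < f.leadingCoeff :=
  lt_of_le_of_ne (hf _) (leadingCoeff_ne_zero.mpr h0).symm

theorem Interlaces.splits_left {f g : ℝ[X]} (h : Interlaces g f) : g.Splits := by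
  rcases h with ⟨rfl, -⟩ | ⟨-, h⟩ | ⟨h, -⟩
  exacts [Splits.zero, h, h]

theorem Interlaces.splits_right {f g : ℝ[X]} (h : Interlaces g f) : f.Splits := by
  rcases h with ⟨-, h⟩ | ⟨rfl, -⟩ | ⟨-, h, -⟩
  exacts [h, Splits.zero, h]

/-- The interlacing condition on the sections of `h`, indexed by the residue `m` itself; the
sequence runs through the residues in decreasing order. -/
theorem isInterlacingSeq_rSection_iff {r : ℕ} (hr : 0 < r) {h : ℝ[X]} (hh : ∀ i, 0 ≤ h.coeff i) :
    IsInterlacingSeq (fun i : Fin r => rSection r (r - 1 - (i : ℕ)) h) ↔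
      ∀ m m' : ℕ, m < r → m' < m → Interlaces (rSection r m h) (rSection r m' h) := by
  constructor
  · intro H m m' hm hm'
    have := H.2 ⟨r - 1 - m, by omega⟩ ⟨r - 1 - m', by omega⟩ (by simp [Fin.lt_def]; omega)
    simpa [Nat.sub_sub_self (show m ≤ r - 1 by omega),
      Nat.sub_sub_self (show m' ≤ r - 1 by omega)] using this
  · refine fun H => ⟨fun i => ?_, fun i j hij => H _ _ (by omega) ?_⟩
    · refine (em _).imp_right (leadingCoeff_pos_of_coeff_nonneg fun d => ?_)
      rw [coeff_rSection hr]
      exact hh _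
    · have := Fin.lt_def.mp hij
      omega

/-- Multiplication by `1 + x + ⋯ + x^{r-1}` preserves interlacing of the sections. -/
theorem interlaces_rSection_geomSum_mul {r : ℕ} (hr : 0 < r) {h : ℝ[X]} (hh : ∀ i, 0 ≤ h.coeff i)
    (H : ∀ m m' : ℕ, m < r → m' < m → Interlaces (rSection r m h) (rSection r m' h))
    {k k' : ℕ} (hk : k < r) (hkk' : k' < k) :
    Interlaces (rSection r k ((∑ i ∈ Finset.range r, X ^ i) * h))
      (rSection r k' ((∑ i ∈ Finset.range r, X ^ i) * h)) := by
  -- If every section vanishes, so do the new ones; otherwise none of the new ones does.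
  by_cases h0 : ∀ m < r, rSection r m h = 0
  · refine Or.inl ⟨?_, ?_⟩
    · rw [rSection_geomSum_mul hr hk, Finset.sum_eq_zero, Finset.sum_eq_zero, mul_zero, add_zero]
      · intro m hm; exact h0 m (Finset.mem_Ico.mp hm).2
      · intro m hm; exact h0 m (by have := Finset.mem_range.mp hm; omega)
    · rw [rSection_geomSum_mul hr (hkk'.trans hk), Finset.sum_eq_zero, Finset.sum_eq_zero, mul_zero,
        add_zero]
      · exact Splits.zero
      · intro m hm; exact h0 m (Finset.mem_Ico.mp hm).2
      · intro m hm; exact h0 m (by have := Finset.mem_range.mp hm; omega)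
  push Not at h0
  obtain ⟨m₀, hm₀, hne⟩ := h0
  have hsplits : ∀ m < r, (rSection r m h).Splits := by
    intro m hm
    rcases Nat.eq_zero_or_pos m with rfl | hpos
    · exact (H k 0 hk (by omega)).splits_right
    · exact (H m 0 hm hpos).splits_left
  have hord : ∀ z : ℂ, 0 < z.im → ∀ m < r, ∀ m' ≤ m,
      ArgOrdered z (aeval z (rSection r m h)) (aeval z (rSection r m' h)) := by
    intro z hz m hm m' hm'
    rcases hm'.eq_or_lt with rfl | hlt
    · exact ArgOrdered.refl hz _
    · exact (H m m' hm hlt).argOrdered (fun i => by rw [coeff_rSection hr]; exact hh _) hz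
  have haeval : ∀ z : ℂ, ∀ l < r,
      aeval z (rSection r l ((∑ i ∈ Finset.range r, X ^ i) * h)) =
        ∑ m ∈ Finset.range (l + 1), aeval z (rSection r m h) +
          z * ∑ m ∈ Finset.Ico (l + 1) r, aeval z (rSection r m h) := by
    intro z l hl
    rw [rSection_geomSum_mul hr hl, map_add, map_mul, map_sum, map_sum, aeval_X]
  have hnz : ∀ l < r, ∀ z : ℂ, 0 < z.im →
      aeval z (rSection r l ((∑ i ∈ Finset.range r, X ^ i) * h)) ≠ 0 := by
    intro l hl z hz hzero
    rw [haeval z l hl] at hzero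
    have h1 : ArgOrdered z (∑ m ∈ Finset.Ico (l + 1) r, aeval z (rSection r m h))
        (∑ m ∈ Finset.range (l + 1), aeval z (rSection r m h)) := by
      refine ArgOrdered.sum_left fun m hm => ArgOrdered.sum_right fun m' hm' => ?_
      rw [Finset.mem_Ico] at hm
      rw [Finset.mem_range] at hm'
      exact hord z hz m hm.2 m' (by omega)
    obtain ⟨h2, h3⟩ := h1.eq_zero_of_add_mul_eq_zero hz hzero
    refine (hsplits m₀ hm₀).aeval_ne_zero_of_im_pos hne hz ?_
    have h4 := ArgOrdered.eq_zero_of_sum_eq_zero hz _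
      (fun i hi j _ hji => hord z hz i (Finset.mem_Ico.mp hi).2 j hji.le) h2
    have h5 := ArgOrdered.eq_zero_of_sum_eq_zero hz _
      (fun i hi j _ hji => hord z hz i (by have := Finset.mem_range.mp hi; omega) j hji.le) h3
    rcases Nat.lt_or_ge m₀ (l + 1) with hlt | hge
    · exact h5 m₀ (Finset.mem_range.mpr hlt)
    · exact h4 m₀ (Finset.mem_Ico.mpr ⟨hge, hm₀⟩)
  have hlc : ∀ l < r, 0 < (rSection r l ((∑ i ∈ Finset.range r, X ^ i) * h)).leadingCoeff := by
    intro l hl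
    refine leadingCoeff_pos_of_coeff_nonneg (fun i => ?_) fun hzero => ?_
    · rw [coeff_rSection hr]
      exact coeff_geomSum_mul_nonneg r hh _
    · exact hnz l hl Complex.I (by simp) (by rw [hzero, map_zero])
  have hk' : k' < r := hkk'.trans hk
  refine interlaces_of_im_nonneg (splits_of_aeval_ne_zero (hnz k' hk'))
    (splits_of_aeval_ne_zero (hnz k hk)) (hlc k' hk') (hlc k hk) fun z hz => ?_
  -- the blocks of residues above `k`, in `(k', k]`, and up to `k'`
  rw [haeval z k hk, haeval z k' hk',
    ← Finset.sum_range_add_sum_Ico _ (show k' + 1 ≤ k + 1 by omega),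
    ← Finset.sum_Ico_consecutive _ (show k' + 1 ≤ k + 1 by omega) (show k + 1 ≤ r by omega),
    add_comm (∑ m ∈ Finset.Ico (k' + 1) (k + 1), _)]
  refine ArgOrdered.im_shift_nonneg hz ?_ ?_
  · refine ArgOrdered.sum_left fun m hm => ArgOrdered.sum_right fun m' hm' => ?_
    rw [Finset.mem_Ico] at hm hm'
    exact hord z hz m hm.2 m' (by omega)
  · refine ArgOrdered.sum_left fun m hm => ArgOrdered.sum_right fun m' hm' => ?_
    rw [Finset.mem_Ico] at hm
    rw [Finset.mem_range] at hm'
    exact hord z hz m (by omega) m' (by omega)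

theorem theorem1p4 (n r : ℕ) (hn : 0 < n) (hr : 0 < r) (h : Polynomial ℝ)
    (hnonneg : ∀ i, 0 ≤ h.coeff i)
    (hint : IsInterlacingSeq (fun i : Fin r => rSection r (r - 1 - (i : ℕ)) h)) :
    IsInterlacingSeq (fun i : Fin r => veroneseU n r (r - 1 - (i : ℕ)) h) := by
  unfold veroneseU
  clear hn
  suffices H : (∀ i, 0 ≤ ((∑ i ∈ Finset.range r, X ^ i) ^ n * h).coeff i) ∧
      ∀ m m' : ℕ, m < r → m' < m →
        Interlaces (rSection r m ((∑ i ∈ Finset.range r, X ^ i) ^ n * h))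
          (rSection r m' ((∑ i ∈ Finset.range r, X ^ i) ^ n * h)) from
    (isInterlacingSeq_rSection_iff hr H.1).mpr H.2
  induction n with
  | zero =>
    simp only [pow_zero, one_mul]
    exact ⟨hnonneg, (isInterlacingSeq_rSection_iff hr hnonneg).mp hint⟩
  | succ n ih =>
    rw [pow_succ', mul_assoc]
    exact ⟨coeff_geomSum_mul_nonneg r ih.1, fun m m' hm hm' =>
      interlaces_rSection_geomSum_mul hr ih.1 ih.2 hm hm'⟩
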